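/- Let $X_1,X_2,\dots$ be i.i.d. random variables with values in a measurable space $\mathcal X$, let $\Theta$ be a measurable space, let $f:\Theta\times\mathcal X\to[0,1]$ be measurable, and put $\mu_\theta=\mathbb E[f(\theta,X_1)]$. Let $P_0$ be a probability measure on $\Theta$ that does not depend on the data, and let $\delta\in(0,1]$. For $n\in\mathbb N$, $\theta\in\Theta$ and $m\in[0,1]$ let $$\psi_n^{\star}(\theta,m)=\max_{\lambda\in[-\frac1{1-m},\frac1m]}\ \sum_{i=1}^n\ln\bigl(1+\lambda\,(f(\theta,X_i)-m)\bigr)\in[0,\infty],$$ where $\ln 0=-\infty$, $1/0=\infty$, and for $m\in\{0,1\}$ the maximum is the supremum over the real numbers $\lambda$ in the range. For a data-dependent probability measure $P_n$ on $\Theta$ (a probability kernel from $\mathcal X^n$ to $\Theta$, evaluated at $(X_1,\dots,X_n)$) let $$\mathcal C_n=\mathrm{KL}(P_n\,\|\,P_0)+\ln\frac{\sqrt\pi\,\Gamma(n+1)}{\Gamma(n+\frac12)},$$ with $\mathrm{KL}(P_n\,\|\,P_0)=\infty$ if $P_n\not\ll P_0$, and let $M_U$ and $M_L$ be the maximum and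 the minimum of $$\int\nu_\theta\,dP_n(\theta)\quad\text{over measurable }\nu:\Theta\to[0,1]\ \text{ subject to }\ \int\psi_n^{\star}(\theta,\nu_\theta)\,dP_n(\theta)\le\mathcal C_n+\ln\frac1\delta .$$ The maximum and the minimum exist for every $n$, every sample and every $P_n$, and with probability at least $1-\delta$, simultaneously for all $n\in\mathbb N$ and all data-dependent $P_n$, $$M_L\le\int\mu_\theta\,dP_n(\theta)\le M_U .$$ -/

import Mathlib

open MeasureTheory ProbabilityTheory

noncomputable section

/-- The betting range `[-1/(1-m), 1/m]` for `m ∈ [0,1]`, with `1/0 = ∞`; clearing the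
denominators makes the end points right also for `m = 0` and `m = 1`. -/
def betRange (m : ℝ) : Set ℝ :=
  {l | -1 ≤ l * (1 - m) ∧ l * m ≤ 1}

/-- The optimal log-wealth
`ψ⋆(m) = sup_{l ∈ [-1/(1-m), 1/m]} ∑ i, ln (1 + l (c i - m))` of the outcomes
`c 0, …, c (n-1) ∈ [0,1]`, with values in the extended reals: `ENNReal.log 0 = -∞`, and the
supremum may be `+∞` when `m ∈ {0, 1}`. -/
def optLogWealth {n : ℕ} (c : Fin n → ℝ) (m : ℝ) : EReal :=
  ⨆ l ∈ betRange m, ∑ i, ENNReal.log (ENNReal.ofReal (1 + l * (c i - m)))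

/-- The optimal log-wealth is nonnegative, so `EReal.toENNReal` loses nothing on it. -/
theorem optLogWealth_nonneg {n : ℕ} (c : Fin n → ℝ) (m : ℝ) : 0 ≤ optLogWealth c m := by
  have h : (0 : ℝ) ∈ betRange m := by simp [betRange]
  refine le_trans ?_ (le_iSup₂ (f := fun (l : ℝ) (_ : l ∈ betRange m) =>
    ∑ i, ENNReal.log (ENNReal.ofReal (1 + l * (c i - m)))) 0 h)
  simp

/-- `C_n = KL(Q ‖ P₀) + ln (√π Γ(n+1) / Γ(n+1/2))`. -/
def complexity {Θ : Type*} [MeasurableSpace Θ] (P₀ Q : Measure Θ) (n : ℕ) : EReal :=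
  (InformationTheory.klDiv Q P₀ : EReal) +
    (Real.log (√Real.pi * Real.Gamma (n + 1) / Real.Gamma (n + 1 / 2)) : EReal)

/-- The candidate mean functions: measurable `ν : Θ → [0,1]` with
`∫ ψ⋆_n(θ, ν θ) dQ(θ) ≤ C_n + ln (1/δ)`, for the sample `x` of size `n`. -/
def feasibleMeans {Θ 𝒳 : Type*} [MeasurableSpace Θ] (f : Θ × 𝒳 → ℝ) (P₀ Q : Measure Θ)
    (δ : ℝ) {n : ℕ} (x : Fin n → 𝒳) : Set (Θ → ℝ) :=
  {ν | Measurable ν ∧ (∀ θ, ν θ ∈ Set.Icc (0 : ℝ) 1) ∧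
    ((∫⁻ θ, (optLogWealth (fun i => f (θ, x i)) (ν θ)).toENNReal ∂Q : ENNReal) : EReal)
      ≤ complexity P₀ Q n + (Real.log (1 / δ) : EReal)}

/-- The objective values `∫ ν dQ` of the feasible mean functions `ν`. -/
def objectiveValues {Θ 𝒳 : Type*} [MeasurableSpace Θ] (f : Θ × 𝒳 → ℝ) (P₀ Q : Measure Θ)
    (δ : ℝ) {n : ℕ} (x : Fin n → 𝒳) : Set ℝ :=
  (fun ν : Θ → ℝ => ∫ θ, ν θ ∂Q) '' feasibleMeans f P₀ Q δ x

/-- `M_U`, the optimal value of the maximization problem. -/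
def maxMean {Θ 𝒳 : Type*} [MeasurableSpace Θ] (f : Θ × 𝒳 → ℝ) (P₀ Q : Measure Θ)
    (δ : ℝ) {n : ℕ} (x : Fin n → 𝒳) : ℝ :=
  sSup (objectiveValues f P₀ Q δ x)

/-- `M_L`, the optimal value of the minimization problem. -/
def minMean {Θ 𝒳 : Type*} [MeasurableSpace Θ] (f : Θ × 𝒳 → ℝ) (P₀ Q : Measure Θ)
    (δ : ℝ) {n : ℕ} (x : Fin n → 𝒳) : ℝ :=
  sInf (objectiveValues f P₀ Q δ x)

end

/-! Split a unit stake between the outcomes `1` and `0` in proportion `p : 1 - p`, at odds that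
are fair for the mean `m`. Drawing `p` from `Beta(1/2, 1/2)` gives a wealth with mean at most one
at the true mean `m = μ_θ`, while for every sample it is at least the wealth of the best constant
bet divided by `√π Γ(n+1) / Γ(n+1/2)`. The Ville inequality, applied to the average of this wealth
over `θ ∼ P₀`, keeps it below `1/δ` for all `n` at once, with probability at least `1 - δ`. On
that event the Donsker–Varadhan inequality, which changes the measure from `P₀` to `P_n`, makes
`θ ↦ μ_θ` feasible.

The extrema are attained because the feasible set is closed, convex and bounded in `L²(P_n)`, so
that the objective, a continuous linear functional, maps it to a compact set of reals. This rests
on the convexity and lower semicontinuity of `ψ⋆` in `m`; the empirical means give a feasible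
point. -/

open Filter Topology
open scoped ENNReal NNReal

noncomputable section

/-! ### The Krichevsky–Trofimov regret -/

theorem inv_add_half_le_log_add_one_sub_log {x : ℝ} (hx : 0 < x) :
    1 / (x + 1 / 2) ≤ Real.log (x + 1) - Real.log x := by
  have h := Real.le_log_one_add_of_nonneg (one_div_pos.2 hx).le
  rw [← Real.log_div (by positivity) hx.ne']
  convert h using 1
  · field_simp; ring
  · congr 1; field_simp

theorem antitoneOn_log_add_half_sub_mul_log :
    AntitoneOn (fun x : ℝ => Real.log (x + 1 / 2) - (x + 1) * Real.log (x + 1) + x * Real.log x)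
      (Set.Ici 0) := by
  refine antitoneOn_of_hasDerivWithinAt_nonpos (convex_Ici 0)
    (f' := fun x => 1 / (x + 1 / 2) - (Real.log (x + 1) + 1) + (Real.log x + 1)) ?_ ?_ ?_
  · refine ContinuousOn.add (ContinuousOn.sub ?_ ?_) Real.continuous_mul_log.continuousOn
    · exact ContinuousOn.log (by fun_prop) fun x (hx : 0 ≤ x) => by positivity
    · exact (Real.continuous_mul_log.comp (continuous_add_const 1)).continuousOn
  · intro x hx
    rw [interior_Ici, Set.mem_Ioi] at hx
    have h₁ := ((hasDerivAt_id' x).add_const (1 / 2 : ℝ)).log (by positivity)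
    have h₂ := (Real.hasDerivAt_mul_log (by positivity : x + 1 ≠ 0)).comp x
      ((hasDerivAt_id' x).add_const 1)
    have h₃ := Real.hasDerivAt_mul_log hx.ne'
    rw [mul_one] at h₂
    exact ((h₁.sub h₂).add h₃).hasDerivWithinAt
  · intro x hx
    rw [interior_Ici, Set.mem_Ioi] at hx
    linarith [inv_add_half_le_log_add_one_sub_log hx]

theorem log_Gamma_add_half_sub_mul_log_le (k j : ℕ) :
    Real.log √Real.pi + (Real.log (Real.Gamma ((k + j : ℕ) + 1 / 2)) -
        (k + j : ℕ) * Real.log (k + j : ℕ)) ≤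
      (Real.log (Real.Gamma (k + 1 / 2)) - k * Real.log k) +
        (Real.log (Real.Gamma (j + 1 / 2)) - j * Real.log j) := by
  have log_Gamma_succ (n : ℕ) : Real.log (Real.Gamma ((n + 1 : ℕ) + 1 / 2)) =
      Real.log (n + 1 / 2) + Real.log (Real.Gamma (n + 1 / 2)) := by
    rw [← Real.log_mul (by positivity) (Real.Gamma_pos_of_pos (by positivity)).ne',
      ← Real.Gamma_add_one (by positivity)]
    push_cast; ring_nf
  induction j with
  | zero => simp [-one_div, Real.Gamma_one_half_eq, add_comm]
  | succ j ih =>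
    have h := antitoneOn_log_add_half_sub_mul_log (a := (j : ℝ)) (b := (k + j : ℕ))
      (Set.mem_Ici.2 j.cast_nonneg) (Set.mem_Ici.2 (k + j).cast_nonneg)
      (Nat.cast_le.2 (Nat.le_add_left j k))
    rw [← add_assoc, log_Gamma_succ, log_Gamma_succ]
    push_cast at h ih ⊢
    linarith

theorem sqrt_pi_mul_Gamma_add_half_mul_pow_le (k j : ℕ) :
    √Real.pi * Real.Gamma ((k + j : ℕ) + 1 / 2) * ((k : ℝ) ^ k * (j : ℝ) ^ j) ≤
      Real.Gamma (k + 1 / 2) * Real.Gamma (j + 1 / 2) * ((k + j : ℕ) : ℝ) ^ (k + j) := by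
  have Gamma_pos (n : ℕ) : 0 < Real.Gamma (n + 1 / 2) := Real.Gamma_pos_of_pos (by positivity)
  have pow_pos (n : ℕ) : 0 < (n : ℝ) ^ n := by
    rcases n.eq_zero_or_pos with rfl | hn <;> positivity
  have : 0 < √Real.pi := Real.sqrt_pos.2 Real.pi_pos
  have := Gamma_pos k
  have := Gamma_pos j
  have := Gamma_pos (k + j)
  have := pow_pos k
  have := pow_pos j
  have := pow_pos (k + j)
  rw [← Real.log_le_log_iff (by positivity) (by positivity)]
  have h := log_Gamma_add_half_sub_mul_log_le k j
  repeat rw [Real.log_mul (by positivity) (by positivity)]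
  simp only [Real.log_pow]
  linarith

theorem pow_le_pow_mul_exp_sub (k : ℕ) {x : ℝ} (hx : 0 ≤ x) :
    x ^ k ≤ (k : ℝ) ^ k * Real.exp (x - k) := by
  rcases k.eq_zero_or_pos with rfl | hk
  · simpa using hx
  have hk : (0 : ℝ) < k := Nat.cast_pos.2 hk
  calc x ^ k = (k : ℝ) ^ k * (x / k) ^ k := by rw [← mul_pow, mul_div_cancel₀ _ hk.ne']
    _ ≤ (k : ℝ) ^ k * Real.exp (x / k - 1) ^ k := by
        gcongr; linarith [Real.add_one_le_exp (x / k - 1)]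
    _ = (k : ℝ) ^ k * Real.exp (x - k) := by
        rw [← Real.exp_nat_mul, mul_sub, mul_div_cancel₀ _ hk.ne', mul_one]

theorem pow_mul_pow_mul_pow_add_le {p q : ℝ} (hp : 0 ≤ p) (hq : 0 ≤ q) (hpq : p + q = 1)
    (k j : ℕ) :
    p ^ k * q ^ j * ((k + j : ℕ) : ℝ) ^ (k + j) ≤ (k : ℝ) ^ k * (j : ℝ) ^ j := by
  set n : ℝ := ((k + j : ℕ) : ℝ) with hn
  have : 0 ≤ n := Nat.cast_nonneg _
  calc p ^ k * q ^ j * n ^ (k + j) = (p * n) ^ k * (q * n) ^ j := by ring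
    _ ≤ ((k : ℝ) ^ k * Real.exp (p * n - k)) * ((j : ℝ) ^ j * Real.exp (q * n - j)) := by
        gcongr <;> exact pow_le_pow_mul_exp_sub _ (by positivity)
    _ = (k : ℝ) ^ k * (j : ℝ) ^ j * Real.exp (p * n - k + (q * n - j)) := by
        rw [Real.exp_add]; ring
    _ = (k : ℝ) ^ k * (j : ℝ) ^ j := by
        have : p * n - k + (q * n - j) = 0 := by
          push_cast at hn; linear_combination n * hpq + hn
        rw [this, Real.exp_zero, mul_one]

/-- The worst-case ratio `√π Γ(n+1) / Γ(n+1/2)` between the likelihood of `n` coin flips under the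
best bias and their likelihood under the Krichevsky–Trofimov mixture of biases. -/
def ktRegret (n : ℕ) : ℝ := √Real.pi * Real.Gamma (n + 1) / Real.Gamma (n + 1 / 2)

theorem ktRegret_pos (n : ℕ) : 0 < ktRegret n :=
  div_pos (mul_pos (Real.sqrt_pos.2 Real.pi_pos) (Real.Gamma_pos_of_pos (by positivity)))
    (Real.Gamma_pos_of_pos (by positivity))

theorem one_le_ktRegret (n : ℕ) : 1 ≤ ktRegret n := by
  induction n with
  | zero => simp [ktRegret, -one_div, Real.Gamma_one_half_eq, (Real.sqrt_pos.2 Real.pi_pos).ne']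
  | succ n ih =>
    have hsucc : ktRegret (n + 1) = (n + 1) / (n + 1 / 2) * ktRegret n := by
      rw [ktRegret, ktRegret, Nat.cast_add_one,
        Real.Gamma_add_one (s := (n : ℝ) + 1) (by positivity), add_right_comm (n : ℝ),
        Real.Gamma_add_one (s := (n : ℝ) + 1 / 2) (by positivity), mul_left_comm,
        mul_div_mul_comm]
    have hfactor : 1 ≤ ((n : ℝ) + 1) / (n + 1 / 2) := (one_le_div (by positivity)).2 (by linarith)
    exact hsucc ▸ one_le_mul_of_one_le_of_one_le hfactor ih

theorem ktRegret_mul_beta_div_beta (k j : ℕ) :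
    ktRegret (k + j) * (beta (1 / 2 + k) (1 / 2 + j) / beta (1 / 2) (1 / 2)) =
      Real.Gamma (k + 1 / 2) * Real.Gamma (j + 1 / 2) /
        (√Real.pi * Real.Gamma ((k + j : ℕ) + 1 / 2)) := by
  have hsum : (1 / 2 + k + (1 / 2 + j) : ℝ) = (k + j : ℕ) + 1 := by push_cast; ring
  have hΓ : Real.Gamma ((k + j : ℕ) + 1) ≠ 0 := (Real.Gamma_pos_of_pos (by positivity)).ne'
  have hπ : √Real.pi ≠ 0 := (Real.sqrt_pos.2 Real.pi_pos).ne'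
  rw [ktRegret, beta, beta, hsum, add_halves, Real.Gamma_one, Real.Gamma_one_half_eq,
    add_comm (1 / 2 : ℝ) k, add_comm (1 / 2 : ℝ) j]
  field_simp

theorem pow_mul_pow_le_ktRegret_mul_beta {p q : ℝ} (hp : 0 ≤ p) (hq : 0 ≤ q) (hpq : p + q = 1)
    (k j : ℕ) :
    p ^ k * q ^ j ≤
      ktRegret (k + j) * (beta (1 / 2 + k) (1 / 2 + j) / beta (1 / 2) (1 / 2)) := by
  have : 0 < Real.Gamma ((k + j : ℕ) + 1 / 2) := Real.Gamma_pos_of_pos (by positivity)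
  have hn : 0 < ((k + j : ℕ) : ℝ) ^ (k + j) := by
    rcases (k + j).eq_zero_or_pos with h | h
    · simp [h]
    · positivity
  rw [ktRegret_mul_beta_div_beta, le_div_iff₀ (by positivity)]
  refine le_of_mul_le_mul_right ?_ hn
  calc p ^ k * q ^ j * (√Real.pi * Real.Gamma ((k + j : ℕ) + 1 / 2)) * ((k + j : ℕ) : ℝ) ^ (k + j)
      = √Real.pi * Real.Gamma ((k + j : ℕ) + 1 / 2) *
          (p ^ k * q ^ j * ((k + j : ℕ) : ℝ) ^ (k + j)) := by ring
    _ ≤ √Real.pi * Real.Gamma ((k + j : ℕ) + 1 / 2) * ((k : ℝ) ^ k * (j : ℝ) ^ j) := by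
        exact mul_le_mul_of_nonneg_left (pow_mul_pow_mul_pow_add_le hp hq hpq k j) (by positivity)
    _ ≤ _ := sqrt_pi_mul_Gamma_add_half_mul_pow_le k j

theorem measurable_betaPDF (α β : ℝ) : Measurable (betaPDF α β) :=
  (measurable_betaPDFReal α β).ennreal_ofReal

theorem lintegral_pow_mul_pow_betaMeasure {α β : ℝ} (hα : 0 < α) (hβ : 0 < β) (k j : ℕ) :
    ∫⁻ p, ENNReal.ofReal p ^ k * ENNReal.ofReal (1 - p) ^ j ∂betaMeasure α β =
      ENNReal.ofReal (beta (α + k) (β + j) / beta α β) := by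
  have hb := beta_pos hα hβ
  have hb' := beta_pos (add_pos_of_pos_of_nonneg hα k.cast_nonneg)
    (add_pos_of_pos_of_nonneg hβ j.cast_nonneg)
  have hpdf (p : ℝ) : betaPDF α β p * (ENNReal.ofReal p ^ k * ENNReal.ofReal (1 - p) ^ j) =
      ENNReal.ofReal (beta (α + k) (β + j) / beta α β) * betaPDF (α + k) (β + j) p := by
    by_cases hp : 0 < p ∧ p < 1
    · have hp' := sub_pos.2 hp.2
      rw [betaPDF_of_pos_lt_one hp.1 hp.2, betaPDF_of_pos_lt_one hp.1 hp.2]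
      generalize 1 - p = q at hp' ⊢
      replace hp := hp.1
      rw [← ENNReal.ofReal_pow hp.le, ← ENNReal.ofReal_pow hp'.le,
        ← ENNReal.ofReal_mul (by positivity), ← ENNReal.ofReal_mul (by positivity),
        ← ENNReal.ofReal_mul (by positivity), show α + k - 1 = α - 1 + k by ring,
        show β + j - 1 = β - 1 + j by ring, Real.rpow_add_natCast hp.ne',
        Real.rpow_add_natCast hp'.ne']
      congr 1
      field_simp
    · simp [betaPDF_eq, if_neg hp]
  rw [betaMeasure, lintegral_withDensity_eq_lintegral_mul₀
    (measurable_betaPDF α β).aemeasurable (by fun_prop)]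
  simp only [Pi.mul_apply, hpdf]
  rw [lintegral_const_mul _ (measurable_betaPDF _ _), lintegral_betaPDF_eq_one
    (by positivity) (by positivity), mul_one]

theorem ae_mem_Icc_betaMeasure (α β : ℝ) : ∀ᵐ p ∂betaMeasure α β, p ∈ Set.Icc (0 : ℝ) 1 := by
  rw [betaMeasure, ae_withDensity_iff (measurable_betaPDF α β)]
  filter_upwards with p hp
  by_contra h
  refine hp ?_
  rw [betaPDF_eq, if_neg fun h' => h ⟨h'.1.le, h'.2.le⟩, ENNReal.ofReal_zero]

/-! ### The universal wealth -/

/-- The return at outcome `c` of a unit stake split between the outcomes `1` and `0` in proportion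
`p : 1 - p`, at odds that are fair when the mean outcome is `m`. For `m ∈ {0, 1}` the side that
cannot win has odds `c / 0`, which in `ℝ≥0∞` is `0` if `c = 0` and `∞` otherwise. -/
def fairPayoff (p m c : ℝ) : ℝ≥0∞ :=
  ENNReal.ofReal p * (ENNReal.ofReal c / ENNReal.ofReal m) +
    ENNReal.ofReal (1 - p) * (ENNReal.ofReal (1 - c) / ENNReal.ofReal (1 - m))

/-- The Krichevsky–Trofimov universal wealth: the average over `p ∼ Beta(1/2, 1/2)` of the wealth
earned on the outcomes `c` by always staking the proportions `p : 1 - p`. -/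
def mixtureWealth {n : ℕ} (c : Fin n → ℝ) (m : ℝ) : ℝ≥0∞ :=
  ∫⁻ p, ∏ i, fairPayoff p m (c i) ∂betaMeasure (1 / 2) (1 / 2)

@[fun_prop]
theorem measurable_fairPayoff {α : Type*} [MeasurableSpace α] {p m c : α → ℝ} (hp : Measurable p)
    (hm : Measurable m) (hc : Measurable c) : Measurable fun a => fairPayoff (p a) (m a) (c a) := by
  unfold fairPayoff
  fun_prop

theorem lintegral_fairPayoff_le_one {α : Type*} [MeasurableSpace α] {ρ : Measure α}
    [IsProbabilityMeasure ρ] {g : α → ℝ} (hg : Measurable g) (hg01 : ∀ a, g a ∈ Set.Icc (0 : ℝ) 1)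
    {p : ℝ} (hp : p ∈ Set.Icc (0 : ℝ) 1) :
    ∫⁻ a, fairPayoff p (∫ a, g a ∂ρ) (g a) ∂ρ ≤ 1 := by
  have hint : Integrable g ρ := Integrable.of_bound hg.aestronglyMeasurable 1
    (ae_of_all _ fun a => by rw [Real.norm_of_nonneg (hg01 a).1]; exact (hg01 a).2)
  have lintegral_div_le_one {h : α → ℝ} (hh : Integrable h ρ) (h0 : ∀ a, 0 ≤ h a) :
      ∫⁻ a, ENNReal.ofReal (h a) / ENNReal.ofReal (∫ a, h a ∂ρ) ∂ρ ≤ 1 := by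
    simp only [div_eq_mul_inv]
    rw [lintegral_mul_const'' _ hh.aemeasurable.ennreal_ofReal,
      ← ofReal_integral_eq_lintegral_ofReal hh (ae_of_all _ h0)]
    exact ENNReal.div_self_le_one
  have hsub : 1 - ∫ a, g a ∂ρ = ∫ a, (1 - g a) ∂ρ := by
    rw [integral_sub (integrable_const 1) hint]; simp
  unfold fairPayoff
  rw [hsub, lintegral_add_left (by fun_prop), lintegral_const_mul _ (by fun_prop),
    lintegral_const_mul _ (by fun_prop)]
  calc _ ≤ ENNReal.ofReal p * 1 + ENNReal.ofReal (1 - p) * 1 := by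
        gcongr
        · exact lintegral_div_le_one hint fun a => (hg01 a).1
        · exact lintegral_div_le_one ((integrable_const 1).sub hint)
            fun a => sub_nonneg.2 (hg01 a).2
    _ = 1 := by
        rw [mul_one, mul_one, ← ENNReal.ofReal_add hp.1 (sub_nonneg.2 hp.2), add_sub_cancel,
          ENNReal.ofReal_one]

theorem mixtureWealth_eq_sum {n : ℕ} (c : Fin n → ℝ) (m : ℝ) :
    mixtureWealth c m = ∑ s : Finset (Fin n),
      ENNReal.ofReal (beta (1 / 2 + s.card) (1 / 2 + sᶜ.card) / beta (1 / 2) (1 / 2)) *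
        ((∏ i ∈ s, ENNReal.ofReal (c i) / ENNReal.ofReal m) *
          ∏ i ∈ sᶜ, ENNReal.ofReal (1 - c i) / ENNReal.ofReal (1 - m)) := by
  unfold mixtureWealth fairPayoff
  simp only [Finset.prod_add, Finset.powerset_univ, Finset.prod_mul_distrib, Finset.prod_const,
    ← Finset.compl_eq_univ_sdiff]
  rw [lintegral_finsetSum _ fun s _ => by fun_prop]
  refine Finset.sum_congr rfl fun s _ => ?_
  rw [← lintegral_pow_mul_pow_betaMeasure one_half_pos one_half_pos, ← lintegral_mul_const _
    (by fun_prop)]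
  exact lintegral_congr fun p => mul_mul_mul_comm _ _ _ _

theorem pow_mul_pow_le_ktRegret_mul_beta_mul_inv {m A B : ℝ} (hm : m ∈ Set.Icc (0 : ℝ) 1)
    (hA : 0 ≤ A) (hB : 0 ≤ B) (hAB : m * A + (1 - m) * B = 1) (k j : ℕ) :
    ENNReal.ofReal A ^ k * ENNReal.ofReal B ^ j ≤
      ENNReal.ofReal (ktRegret (k + j)) *
        ENNReal.ofReal (beta (1 / 2 + k) (1 / 2 + j) / beta (1 / 2) (1 / 2)) *
          ((ENNReal.ofReal m)⁻¹ ^ k * (ENNReal.ofReal (1 - m))⁻¹ ^ j) := by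
  have hm' := sub_nonneg.2 hm.2
  have hbeta : 0 < beta (1 / 2 + k) (1 / 2 + j) / beta (1 / 2) (1 / 2) :=
    div_pos (beta_pos (by positivity) (by positivity)) (beta_pos one_half_pos one_half_pos)
  rw [← ENNReal.ofReal_mul (ktRegret_pos _).le, ← ENNReal.inv_pow, ← ENNReal.inv_pow,
    ← ENNReal.mul_inv (by simp) (by simp), ← div_eq_mul_inv, ENNReal.le_div_iff_mul_le
      (.inr (ENNReal.ofReal_pos.2 (mul_pos (ktRegret_pos _) hbeta)).ne')
      (.inr ENNReal.ofReal_ne_top)]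
  calc ENNReal.ofReal A ^ k * ENNReal.ofReal B ^ j *
        (ENNReal.ofReal m ^ k * ENNReal.ofReal (1 - m) ^ j)
      = ENNReal.ofReal ((m * A) ^ k * ((1 - m) * B) ^ j) := by
        rw [ENNReal.ofReal_mul (pow_nonneg (mul_nonneg hm.1 hA) k), ENNReal.ofReal_pow
          (mul_nonneg hm.1 hA), ENNReal.ofReal_pow (mul_nonneg hm' hB), ENNReal.ofReal_mul hm.1,
          ENNReal.ofReal_mul hm']
        ring
    _ ≤ _ := ENNReal.ofReal_le_ofReal <| pow_mul_pow_le_ktRegret_mul_beta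
        (mul_nonneg hm.1 hA) (mul_nonneg hm' hB) hAB k j

theorem prod_le_ktRegret_mul_mixtureWealth {n : ℕ} {c : Fin n → ℝ}
    (hc : ∀ i, c i ∈ Set.Icc (0 : ℝ) 1) {m A B : ℝ} (hm : m ∈ Set.Icc (0 : ℝ) 1)
    (hA : 0 ≤ A) (hB : 0 ≤ B) (hAB : m * A + (1 - m) * B = 1) :
    ∏ i, ENNReal.ofReal (A * c i + B * (1 - c i)) ≤
      ENNReal.ofReal (ktRegret n) * mixtureWealth c m := by
  have hadd (i : Fin n) : ENNReal.ofReal (A * c i + B * (1 - c i)) =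
      ENNReal.ofReal A * ENNReal.ofReal (c i) + ENNReal.ofReal B * ENNReal.ofReal (1 - c i) := by
    rw [← ENNReal.ofReal_mul hA, ← ENNReal.ofReal_mul hB, ENNReal.ofReal_add
      (mul_nonneg hA (hc i).1) (mul_nonneg hB (sub_nonneg.2 (hc i).2))]
  simp only [hadd, Finset.prod_add, Finset.powerset_univ, ← Finset.compl_eq_univ_sdiff,
    mixtureWealth_eq_sum, Finset.mul_sum]
  refine Finset.sum_le_sum fun s _ => ?_
  have h := pow_mul_pow_le_ktRegret_mul_beta_mul_inv hm hA hB hAB s.card sᶜ.card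
  rw [Finset.card_add_card_compl, Fintype.card_fin] at h
  simp only [div_eq_mul_inv (ENNReal.ofReal _), Finset.prod_mul_distrib, Finset.prod_const]
  calc _ = (ENNReal.ofReal A ^ s.card * ENNReal.ofReal B ^ sᶜ.card) *
        ((∏ i ∈ s, ENNReal.ofReal (c i)) * ∏ i ∈ sᶜ, ENNReal.ofReal (1 - c i)) := by ring
    _ ≤ _ := mul_le_mul_left h _
    _ = _ := by ring

theorem sum_log_eq_log_prod {ι : Type*} (s : Finset ι) (y : ι → ℝ≥0∞) :
    ∑ i ∈ s, ENNReal.log (y i) = ENNReal.log (∏ i ∈ s, y i) := by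
  induction s using Finset.cons_induction with
  | empty => simp
  | cons i s hi ih => rw [Finset.sum_cons, Finset.prod_cons, ENNReal.log_mul_add, ih]

theorem exp_optLogWealth_le_ktRegret_mul_mixtureWealth {n : ℕ} {c : Fin n → ℝ}
    (hc : ∀ i, c i ∈ Set.Icc (0 : ℝ) 1) {m : ℝ} (hm : m ∈ Set.Icc (0 : ℝ) 1) :
    (optLogWealth c m).exp ≤ ENNReal.ofReal (ktRegret n) * mixtureWealth c m := by
  rw [← ENNReal.exp_log (ENNReal.ofReal _ * _), EReal.exp_le_exp_iff]
  refine iSup₂_le fun l hl => ?_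
  rw [sum_log_eq_log_prod, ENNReal.log_le_log_iff]
  have hAB (i : Fin n) :
      1 + l * (c i - m) = (1 + l * (1 - m)) * c i + (1 - l * m) * (1 - c i) := by ring
  simp only [hAB]
  exact prod_le_ktRegret_mul_mixtureWealth hc hm (by linarith [hl.1]) (by linarith [hl.2]) (by ring)

/-! ### A maximal inequality for mixture supermartingales -/

theorem mul_measure_exists_lt_le_setLIntegral {Ω : Type*} {mΩ : MeasurableSpace Ω} {μ : Measure Ω}
    {ℱ : Filtration ℕ mΩ} {F : ℕ → Ω → ℝ≥0∞} (hF : ∀ n, Measurable[ℱ n] (F n))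
    (hstep : ∀ n s, MeasurableSet[ℱ n] s → ∫⁻ ω in s, F (n + 1) ω ∂μ ≤ ∫⁻ ω in s, F n ω ∂μ)
    (t : ℝ≥0∞) (N n : ℕ) {s : Set Ω} (hs : MeasurableSet[ℱ n] s) :
    t * μ (s ∩ {ω | ∃ k < N, t ≤ F (n + k) ω}) ≤ ∫⁻ ω in s, F n ω ∂μ := by
  -- Induction on the horizon: off the event `t ≤ F n`, restart at time `n + 1`.
  induction N generalizing n s with
  | zero => simp
  | succ N ih =>
    set D := {ω | t ≤ F n ω}
    have hDn : MeasurableSet[ℱ n] D := measurableSet_le measurable_const (hF n)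
    have hsplit : s ∩ {ω | ∃ k < N + 1, t ≤ F (n + k) ω} ⊆
        (s ∩ D) ∪ (s \ D) ∩ {ω | ∃ k < N, t ≤ F (n + 1 + k) ω} := by
      rintro ω ⟨hωs, k, hk, hωk⟩
      by_cases hωD : ω ∈ D
      · exact .inl ⟨hωs, hωD⟩
      · obtain _ | k := k
        · exact absurd hωk hωD
        · exact .inr ⟨⟨hωs, hωD⟩, k, by lia, by rwa [add_assoc, add_comm 1]⟩
    have hnow : t * μ (s ∩ D) ≤ ∫⁻ ω in s ∩ D, F n ω ∂μ := by
      rw [← setLIntegral_const]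
      exact setLIntegral_mono ((hF n).mono (ℱ.le n) le_rfl) fun ω hω => hω.2
    have hlater : t * μ ((s \ D) ∩ {ω | ∃ k < N, t ≤ F (n + 1 + k) ω}) ≤
        ∫⁻ ω in s \ D, F n ω ∂μ :=
      (ih (n + 1) (ℱ.mono n.le_succ _ (hs.diff hDn))).trans (hstep n _ (hs.diff hDn))
    calc t * μ (s ∩ {ω | ∃ k < N + 1, t ≤ F (n + k) ω})
        ≤ t * μ (s ∩ D) + t * μ ((s \ D) ∩ {ω | ∃ k < N, t ≤ F (n + 1 + k) ω}) := by
          rw [← mul_add]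
          exact mul_le_mul_right ((measure_mono hsplit).trans (measure_union_le _ _)) _
      _ ≤ ∫⁻ ω in s ∩ D, F n ω ∂μ + ∫⁻ ω in s \ D, F n ω ∂μ := add_le_add hnow hlater
      _ = ∫⁻ ω in s, F n ω ∂μ := lintegral_inter_add_sdiff _ _ (ℱ.le n _ hDn)

theorem mul_measure_exists_le_le_lintegral {Ω : Type*} {mΩ : MeasurableSpace Ω} {μ : Measure Ω}
    {ℱ : Filtration ℕ mΩ} {F : ℕ → Ω → ℝ≥0∞} (hF : ∀ n, Measurable[ℱ n] (F n))
    (hstep : ∀ n s, MeasurableSet[ℱ n] s → ∫⁻ ω in s, F (n + 1) ω ∂μ ≤ ∫⁻ ω in s, F n ω ∂μ)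
    (t : ℝ≥0∞) : t * μ {ω | ∃ n, t ≤ F n ω} ≤ ∫⁻ ω, F 0 ω ∂μ := by
  have hunion : {ω | ∃ n, t ≤ F n ω} = ⋃ N, {ω | ∃ k < N, t ≤ F k ω} := by
    ext ω
    simp only [Set.mem_ofPred_eq, Set.mem_iUnion]
    exact ⟨fun ⟨k, hk⟩ => ⟨k + 1, k, k.lt_succ_self, hk⟩, fun ⟨_, k, _, hk⟩ => ⟨k, hk⟩⟩
  have hmono : Monotone fun N => {ω | ∃ k < N, t ≤ F k ω} :=
    fun N M hNM ω ⟨k, hk, hωk⟩ => ⟨k, hk.trans_le hNM, hωk⟩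
  rw [hunion, hmono.measure_iUnion, ENNReal.mul_iSup]
  refine iSup_le fun N => ?_
  simpa using mul_measure_exists_lt_le_setLIntegral hF hstep t N 0 MeasurableSet.univ

section Independent

variable {Ω 𝒳 α : Type*} [MeasurableSpace Ω] [MeasurableSpace 𝒳] [MeasurableSpace α]

/-- The filtration whose `n`-th σ-algebra is generated by `X 0, …, X (n - 1)`, that is, by the
first `n` observations, in contrast to `Filtration.natural`, which includes `X n`. -/
def pastFiltration (X : ℕ → Ω → 𝒳) (hX : ∀ i, Measurable (X i)) :
    Filtration ℕ (inferInstance : MeasurableSpace Ω) where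
  seq n := ⨆ i ∈ Set.Iio n, MeasurableSpace.comap (X i) inferInstance
  mono' _ _ h := biSup_mono fun _ hi => lt_of_lt_of_le hi h
  le' _ := iSup₂_le fun i _ => (hX i).comap_le

variable {X : ℕ → Ω → 𝒳} {hX : ∀ i, Measurable (X i)} {μ : Measure Ω}
  {π : Measure α} {g : α → 𝒳 → ℝ≥0∞}

theorem measurable_pastFiltration {i n : ℕ} (hi : i < n) :
    Measurable[pastFiltration X hX n] (X i) :=
  Measurable.of_comap_le (le_biSup (fun i => MeasurableSpace.comap (X i) inferInstance) hi)

theorem indep_pastFiltration_comap (hindep : iIndepFun X μ) (n : ℕ) :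
    Indep (pastFiltration X hX n) (MeasurableSpace.comap (X n) inferInstance) μ := by
  have h := indep_iSup_of_disjoint (fun i => (hX i).comap_le) hindep
    (S := Set.Iio n) (T := {n}) (by simp)
  rwa [iSup_singleton] at h

theorem setLIntegral_mul_comp_le (hindep : iIndepFun X μ) {n : ℕ} {s : Set Ω}
    (hs : MeasurableSet[pastFiltration X hX n] s) {G : Ω → ℝ≥0∞}
    (hG : Measurable[pastFiltration X hX n] G) {h : 𝒳 → ℝ≥0∞} (hh : Measurable h)
    (hle : ∫⁻ ω, h (X n ω) ∂μ ≤ 1) :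
    ∫⁻ ω in s, G ω * h (X n ω) ∂μ ≤ ∫⁻ ω in s, G ω ∂μ := by
  have hs' := (pastFiltration X hX).le n s hs
  calc ∫⁻ ω in s, G ω * h (X n ω) ∂μ = ∫⁻ ω, s.indicator G ω * h (X n ω) ∂μ := by
        simp only [← lintegral_indicator hs', Set.indicator_mul_left]
    _ = (∫⁻ ω, s.indicator G ω ∂μ) * ∫⁻ ω, h (X n ω) ∂μ :=
        lintegral_mul_eq_lintegral_mul_lintegral_of_independent_measurableSpace
          ((pastFiltration X hX).le n) (hX n).comap_le (indep_pastFiltration_comap hindep n)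
          (hG.indicator hs) (hh.comp (comap_measurable _))
    _ ≤ ∫⁻ ω in s, G ω ∂μ := by
        rw [lintegral_indicator hs']
        exact mul_le_of_le_one_right' hle

theorem measurable_prod_range_comp {X : ℕ → Ω → 𝒳} {n : ℕ} (hX : ∀ i < n, Measurable (X i))
    (hg : Measurable (Function.uncurry g)) :
    Measurable fun z : α × Ω => ∏ i ∈ Finset.range n, g z.1 (X i z.2) :=
  Finset.measurable_fun_prod _ fun i hi => hg.comp
    (measurable_fst.prodMk ((hX i (Finset.mem_range.1 hi)).comp measurable_snd))

variable [IsProbabilityMeasure μ] [IsProbabilityMeasure π]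

theorem setLIntegral_lintegral_prod_succ_le (hindep : iIndepFun X μ)
    (hg : Measurable (Function.uncurry g)) (hle : ∀ᵐ a ∂π, ∀ i, ∫⁻ ω, g a (X i ω) ∂μ ≤ 1) {n : ℕ}
    {s : Set Ω} (hs : MeasurableSet[pastFiltration X hX n] s) :
    ∫⁻ ω in s, ∫⁻ a, ∏ i ∈ Finset.range (n + 1), g a (X i ω) ∂π ∂μ ≤
      ∫⁻ ω in s, ∫⁻ a, ∏ i ∈ Finset.range n, g a (X i ω) ∂π ∂μ := by
  have hmeas (k : ℕ) : AEMeasurable (Function.uncurry fun ω a => ∏ i ∈ Finset.range k, g a (X i ω))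
      ((μ.restrict s).prod π) :=
    ((measurable_prod_range_comp (fun i _ => hX i) hg).comp measurable_swap).aemeasurable
  rw [lintegral_lintegral_swap (hmeas _), lintegral_lintegral_swap (hmeas _)]
  refine lintegral_mono_ae ?_
  filter_upwards [hle] with a ha
  simp only [Finset.prod_range_succ]
  exact setLIntegral_mul_comp_le hindep hs
    (Finset.measurable_fun_prod _ fun i hi => hg.of_uncurry_left.comp
      (measurable_pastFiltration (Finset.mem_range.1 hi)))
    hg.of_uncurry_left (ha n)

theorem mul_measure_exists_le_lintegral_prod_le (hX : ∀ i, Measurable (X i))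
    (hindep : iIndepFun X μ) (hg : Measurable (Function.uncurry g))
    (hle : ∀ᵐ a ∂π, ∀ i, ∫⁻ ω, g a (X i ω) ∂μ ≤ 1) (t : ℝ≥0∞) :
    t * μ {ω | ∃ n, t ≤ ∫⁻ a, ∏ i : Fin n, g a (X i ω) ∂π} ≤ 1 := by
  have hprod (n : ℕ) (ω : Ω) (a : α) :
      ∏ i : Fin n, g a (X i ω) = ∏ i ∈ Finset.range n, g a (X i ω) :=
    Fin.prod_univ_eq_prod_range (fun i => g a (X i ω)) n
  simp only [hprod]
  refine (mul_measure_exists_le_le_lintegral (ℱ := pastFiltration X hX)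
    (F := fun n ω => ∫⁻ a, ∏ i ∈ Finset.range n, g a (X i ω) ∂π) (fun n => ?_)
    (fun n s hs => setLIntegral_lintegral_prod_succ_le hindep hg hle hs) t).trans (by simp)
  exact @Measurable.lintegral_prod_left' _ _ _ (pastFiltration X hX n) _ _ _
    (@measurable_prod_range_comp _ _ _ (pastFiltration X hX n) _ _ _ _ _
      (fun i hi => measurable_pastFiltration hi) hg)

end Independent

/-! ### The Donsker–Varadhan inequality -/

-- Fenchel–Young: `exp y - 1` is the convex conjugate of `klFun`.
theorem mul_add_one_le_klFun_add_exp {r : ℝ} (hr : 0 ≤ r) (y : ℝ) :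
    r * y + 1 ≤ InformationTheory.klFun r + Real.exp y := by
  rw [InformationTheory.klFun_apply]
  rcases hr.eq_or_lt with rfl | hr
  · simp [Real.exp_nonneg]
  · have hexp : Real.exp y = r * Real.exp (y - Real.log r) := by
      rw [Real.exp_sub, Real.exp_log hr, mul_div_cancel₀ _ hr.ne']
    nlinarith [Real.add_one_le_exp (y - Real.log r)]

theorem mul_add_one_le_ofReal_klFun_add {r : ℝ≥0∞} (hr : r ≠ ∞) {L : ℝ} (hL : 1 ≤ L) (y : ℝ≥0∞) :
    r * y + 1 ≤ ENNReal.ofReal (InformationTheory.klFun r.toReal) +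
      r * ENNReal.ofReal (Real.log L) + (y : EReal).exp / ENNReal.ofReal L := by
  have hL0 : 0 < L := by linarith
  rcases eq_or_ne y ∞ with rfl | hy
  · simp [ENNReal.top_div_of_ne_top ENNReal.ofReal_ne_top]
  lift r to ℝ≥0 using hr
  lift y to ℝ≥0 using hy
  have h := mul_add_one_le_klFun_add_exp r.coe_nonneg (y - Real.log L)
  rw [Real.exp_sub, Real.exp_log hL0] at h
  have hlog := Real.log_nonneg hL
  have hkl := InformationTheory.klFun_nonneg r.coe_nonneg
  rw [ENNReal.coe_toReal, EReal.coe_nnreal_eq_coe_real, EReal.exp_coe,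
    ← ENNReal.ofReal_div_of_pos hL0]
  calc (r * y + 1 : ℝ≥0∞) = ENNReal.ofReal (r * y + 1) := by
        rw [← NNReal.coe_mul, ← NNReal.coe_one, ← NNReal.coe_add, ENNReal.ofReal_coe_nnreal]
        push_cast; rfl
    _ ≤ ENNReal.ofReal (InformationTheory.klFun r + r * Real.log L + Real.exp y / L) :=
        ENNReal.ofReal_le_ofReal (by linarith)
    _ = _ := by
        rw [ENNReal.ofReal_add (by positivity) (by positivity), ENNReal.ofReal_add hkl
          (by positivity), ENNReal.ofReal_mul r.coe_nonneg, ENNReal.ofReal_coe_nnreal]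

theorem lintegral_le_klDiv_add_ofReal_log {α : Type*} [MeasurableSpace α] {P Q : Measure α}
    [IsProbabilityMeasure P] [IsProbabilityMeasure Q] (hac : Q ≪ P) {g : α → ℝ≥0∞}
    (hg : Measurable g) {L : ℝ} (hL : 1 ≤ L)
    (hgL : ∫⁻ a, (g a : EReal).exp ∂P = ENNReal.ofReal L) :
    ∫⁻ a, g a ∂Q ≤ InformationTheory.klDiv Q P + ENNReal.ofReal (Real.log L) := by
  have hr := Q.measurable_rnDeriv P
  have hkl : Measurable fun a => ENNReal.ofReal (InformationTheory.klFun (Q.rnDeriv P a).toReal) :=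
    (InformationTheory.measurable_klFun.comp hr.ennreal_toReal).ennreal_ofReal
  have hexp : ∫⁻ a, (g a : EReal).exp / ENNReal.ofReal L ∂P = 1 := by
    simp only [div_eq_mul_inv]
    rw [lintegral_mul_const' _ _ (ENNReal.inv_ne_top.2 (ENNReal.ofReal_pos.2 (by linarith)).ne'),
      hgL, ENNReal.mul_inv_cancel (ENNReal.ofReal_pos.2 (by linarith)).ne' ENNReal.ofReal_ne_top]
  refine (ENNReal.add_le_add_iff_right ENNReal.one_ne_top).1 ?_
  calc ∫⁻ a, g a ∂Q + 1 = ∫⁻ a, Q.rnDeriv P a * g a + 1 ∂P := by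
        rw [lintegral_add_right _ measurable_const, lintegral_rnDeriv_mul hac hg.aemeasurable,
          lintegral_one, measure_univ]
    _ ≤ ∫⁻ a, ENNReal.ofReal (InformationTheory.klFun (Q.rnDeriv P a).toReal) +
          Q.rnDeriv P a * ENNReal.ofReal (Real.log L) +
            (g a : EReal).exp / ENNReal.ofReal L ∂P := by
        refine lintegral_mono_ae ?_
        filter_upwards [Q.rnDeriv_ne_top P] with a ha
        exact mul_add_one_le_ofReal_klFun_add ha hL (g a)
    _ = InformationTheory.klDiv Q P + ENNReal.ofReal (Real.log L) + 1 := by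
        rw [lintegral_add_left (hkl.fun_add (hr.mul_const _)), lintegral_add_left hkl,
          lintegral_mul_const _ hr, Measure.lintegral_rnDeriv hac, measure_univ, one_mul, hexp,
          InformationTheory.klDiv_eq_lintegral_klFun_of_ac hac]

theorem lintegral_le_klDiv_add_log_lintegral_exp {α : Type*} [MeasurableSpace α] {P Q : Measure α}
    [IsProbabilityMeasure P] [IsProbabilityMeasure Q] {g : α → ℝ≥0∞} (hg : Measurable g) :
    ((∫⁻ a, g a ∂Q : ℝ≥0∞) : EReal) ≤
      InformationTheory.klDiv Q P + ENNReal.log (∫⁻ a, (g a : EReal).exp ∂P) := by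
  have one_le : 1 ≤ ∫⁻ a, (g a : EReal).exp ∂P := by
    calc 1 = ∫⁻ _, 1 ∂P := by simp
      _ ≤ _ := lintegral_mono fun a => by
        rw [← EReal.exp_zero]; exact EReal.exp_monotone (EReal.coe_ennreal_nonneg _)
  have log_nonneg : 0 ≤ ENNReal.log (∫⁻ a, (g a : EReal).exp ∂P) := by
    rw [← ENNReal.log_one]; exact ENNReal.log_monotone one_le
  by_cases hac : Q ≪ P
  · by_cases htop : ∫⁻ a, (g a : EReal).exp ∂P = ∞
    · simp [htop]
    · set L := (∫⁻ a, (g a : EReal).exp ∂P).toReal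
      have hgL : ∫⁻ a, (g a : EReal).exp ∂P = ENNReal.ofReal L := (ENNReal.ofReal_toReal htop).symm
      have hL1 : 1 ≤ L := ENNReal.one_le_ofReal.1 (hgL ▸ one_le)
      rw [hgL, ENNReal.log_ofReal_of_pos (by linarith), ← max_eq_left (Real.log_nonneg hL1),
        ← EReal.coe_ennreal_ofReal, ← EReal.coe_ennreal_add, EReal.coe_ennreal_le_coe_ennreal_iff]
      exact lintegral_le_klDiv_add_ofReal_log hac hg hL1 hgL
  · rw [InformationTheory.klDiv_of_not_ac hac, EReal.coe_ennreal_top,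
      EReal.top_add_of_ne_bot (ne_bot_of_le_ne_bot EReal.zero_ne_bot log_nonneg)]
    exact le_top

/-! ### Integral constraints on functions -/

section Hilbert

variable {F : Type*} [NormedAddCommGroup F] [InnerProductSpace ℝ F]

theorem exists_mem_forall_norm_le [CompleteSpace F] {C : Set F} (hne : C.Nonempty)
    (hcl : IsClosed C) (hconv : Convex ℝ C) : ∃ u ∈ C, ∀ v ∈ C, ‖u‖ ≤ ‖v‖ := by
  obtain ⟨u, hu, hmin⟩ := exists_norm_eq_iInf_of_complete_convex hne hcl.isComplete hconv 0
  simp only [zero_sub, norm_neg] at hmin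
  exact ⟨u, hu, fun v hv => hmin.trans_le <|
    ciInf_le ⟨0, Set.forall_mem_range.2 fun w : C => norm_nonneg (w : F)⟩ ⟨v, hv⟩⟩

theorem sq_norm_sub_le_of_forall_norm_le {C : Set F} (hconv : Convex ℝ C) {u v : F} (hu : u ∈ C)
    (hv : v ∈ C) (hmin : ∀ w ∈ C, ‖u‖ ≤ ‖w‖) : ‖u - v‖ ^ 2 ≤ 2 * (‖v‖ ^ 2 - ‖u‖ ^ 2) := by
  have hmid : ‖u‖ ≤ 1 / 2 * ‖u + v‖ := by
    refine (hmin _ (hconv hu hv one_half_pos.le one_half_pos.le (add_halves 1))).trans_eq ?_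
    rw [← smul_add, norm_smul, Real.norm_of_nonneg one_half_pos.le]
  nlinarith [parallelogram_law_with_norm ℝ u v, norm_nonneg u]

theorem nonempty_iInter_of_antitone_convex [CompleteSpace F] {C : ℕ → Set F} (hC : Antitone C)
    (hne : ∀ k, (C k).Nonempty) (hcl : ∀ k, IsClosed (C k)) (hconv : ∀ k, Convex ℝ (C k))
    (hbdd : Bornology.IsBounded (C 0)) : (⋂ k, C k).Nonempty := by
  -- The points of least norm form a Cauchy sequence, because their norms increase to a limit.
  choose u huC hmin using fun k => exists_mem_forall_norm_le (hne k) (hcl k) (hconv k)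
  have hmono : Monotone fun k => ‖u k‖ ^ 2 := fun k l hkl =>
    pow_le_pow_left₀ (norm_nonneg _) (hmin k _ (hC hkl (huC l))) 2
  obtain ⟨B, hB⟩ := hbdd.exists_norm_le
  have hlim := tendsto_atTop_ciSup hmono
    ⟨B ^ 2, Set.forall_mem_range.2 fun k =>
      pow_le_pow_left₀ (norm_nonneg _) (hB _ (hC k.zero_le (huC k))) 2⟩
  have hcauchy : CauchySeq u := by
    refine Metric.cauchySeq_iff'.2 fun ε hε => ?_
    obtain ⟨N, hN⟩ := Metric.cauchySeq_iff'.1 hlim.cauchySeq (ε ^ 2 / 2) (by positivity)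
    refine ⟨N, fun l hl => ?_⟩
    have h := sq_norm_sub_le_of_forall_norm_le (hconv N) (huC N) (hC hl (huC l)) (hmin N)
    rw [dist_comm, dist_eq_norm]
    exact lt_of_pow_lt_pow_left₀ 2 hε.le (by linarith [(abs_lt.1 (hN l hl)).2])
  obtain ⟨v, hv⟩ := cauchySeq_tendsto_of_complete hcauchy
  exact ⟨v, Set.mem_iInter.2 fun k => (hcl k).mem_of_tendsto hv
    ((eventually_ge_atTop k).mono fun l hl => hC hl (huC l))⟩

theorem isCompact_image_of_isClosed_convex_isBounded [CompleteSpace F] {G : Type*}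
    [NormedAddCommGroup G] [NormedSpace ℝ G] [ProperSpace G] {K : Set F} (hcl : IsClosed K)
    (hconv : Convex ℝ K) (hbdd : Bornology.IsBounded K) (φ : F →L[ℝ] G) : IsCompact (φ '' K) := by
  refine Metric.isCompact_of_isClosed_isBounded (isClosed_of_closure_subset fun s hs => ?_)
    (φ.lipschitz.isBounded_image hbdd)
  set C : ℕ → Set F := fun k => K ∩ φ ⁻¹' Metric.closedBall s (1 / (k + 1))
  obtain ⟨v, hv⟩ : (⋂ k, C k).Nonempty := by
    refine nonempty_iInter_of_antitone_convex (fun k l hkl => ?_) (fun k => ?_) (fun k => ?_)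
      (fun k => ?_) (hbdd.subset Set.inter_subset_left)
    · exact Set.inter_subset_inter_right _ <| Set.preimage_mono <|
        Metric.closedBall_subset_closedBall (Nat.one_div_le_one_div hkl)
    · obtain ⟨_, ⟨u, hu, rfl⟩, h⟩ :=
        Metric.mem_closure_iff.1 hs (1 / (k + 1)) Nat.one_div_pos_of_nat
      exact ⟨u, hu, by rw [Set.mem_preimage, Metric.mem_closedBall, dist_comm]; exact h.le⟩
    · exact hcl.inter (Metric.isClosed_closedBall.preimage φ.continuous)
    · exact hconv.inter ((convex_closedBall _ _).linear_preimage φ.toLinearMap)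
  rw [Set.mem_iInter] at hv
  refine ⟨v, (hv 0).1, dist_le_zero.1 ?_⟩
  exact ge_of_tendsto' tendsto_one_div_add_atTop_nhds_zero_nat fun k => (hv k).2

end Hilbert

section IntegralConstraint

variable {α : Type*} [MeasurableSpace α]

/-- The measurable functions `ν` with values in `C` that obey the integral constraint
`∫ Ψ a (ν a) dQ(a) ≤ b`. -/
def constrainedFunctions (Q : Measure α) (C : Set ℝ) (Ψ : α → ℝ → ℝ≥0∞) (b : ℝ≥0∞) :
    Set (α → ℝ) :=
  {ν | Measurable ν ∧ (∀ a, ν a ∈ C) ∧ ∫⁻ a, Ψ a (ν a) ∂Q ≤ b}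

/-- The classes in `L²(Q)` of the functions in `constrainedFunctions`. -/
def constrainedLp (Q : Measure α) (C : Set ℝ) (Ψ : α → ℝ → ℝ≥0∞) (b : ℝ≥0∞) : Set (Lp ℝ 2 Q) :=
  {u | ∃ ν ∈ constrainedFunctions Q C Ψ b, u =ᵐ[Q] ν}

variable {Q : Measure α} {C : Set ℝ} {Ψ : α → ℝ → ℝ≥0∞} {b : ℝ≥0∞}

theorem convex_constrainedFunctions
    (hmeas : ∀ ν, Measurable ν → (∀ a, ν a ∈ C) → Measurable fun a => Ψ a (ν a))
    (hconv : ∀ a, ConvexOn ℝ≥0 C (Ψ a)) :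
    Convex ℝ≥0 (constrainedFunctions Q C Ψ b) := by
  rintro ν ⟨hν, hνC, hνb⟩ ν' ⟨hν', hνC', hνb'⟩ s t hs ht hst
  refine ⟨(hν.const_smul s).add (hν'.const_smul t),
    fun a => (hconv a).1 (hνC a) (hνC' a) hs ht hst, ?_⟩
  calc ∫⁻ a, Ψ a (s • ν a + t • ν' a) ∂Q
      ≤ ∫⁻ a, s * Ψ a (ν a) + t * Ψ a (ν' a) ∂Q :=
        lintegral_mono fun a => (hconv a).2 (hνC a) (hνC' a) hs ht hst
    _ = s * ∫⁻ a, Ψ a (ν a) ∂Q + t * ∫⁻ a, Ψ a (ν' a) ∂Q := by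
        rw [lintegral_add_left ((hmeas ν hν hνC).const_mul _),
          lintegral_const_mul _ (hmeas ν hν hνC), lintegral_const_mul _ (hmeas ν' hν' hνC')]
    _ ≤ s * b + t * b := by gcongr
    _ = b := by rw [← add_mul, ← ENNReal.coe_add, hst, ENNReal.coe_one, one_mul]

theorem convex_constrainedLp
    (hmeas : ∀ ν, Measurable ν → (∀ a, ν a ∈ C) → Measurable fun a => Ψ a (ν a))
    (hconv : ∀ a, ConvexOn ℝ≥0 C (Ψ a)) : Convex ℝ (constrainedLp Q C Ψ b) := by
  rintro u ⟨ν, hν, hu⟩ v ⟨ν', hν', hv⟩ s t hs ht hst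
  lift s to ℝ≥0 using hs
  lift t to ℝ≥0 using ht
  refine ⟨s • ν + t • ν', convex_constrainedFunctions hmeas hconv hν hν' s.2 t.2
    (NNReal.coe_injective hst), ?_⟩
  filter_upwards [Lp.coeFn_add ((s : ℝ) • u) ((t : ℝ) • v), Lp.coeFn_smul (s : ℝ) u,
    Lp.coeFn_smul (t : ℝ) v, hu, hv] with a hadd hsu htv hua hva
  simp only [hadd, hsu, htv, hua, hva, Pi.add_apply, Pi.smul_apply]
  rfl

theorem lintegral_le_of_tendsto_ae {ν : ℕ → α → ℝ} {w : α → ℝ}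
    (hmeas : ∀ ν, Measurable ν → (∀ a, ν a ∈ C) → Measurable fun a => Ψ a (ν a))
    (hlsc : ∀ a, LowerSemicontinuousOn (Ψ a) C) (hν : ∀ k, ν k ∈ constrainedFunctions Q C Ψ b)
    (hw : ∀ a, w a ∈ C) (hlim : ∀ᵐ a ∂Q, Tendsto (fun k => ν k a) atTop (𝓝 (w a))) :
    ∫⁻ a, Ψ a (w a) ∂Q ≤ b := by
  calc ∫⁻ a, Ψ a (w a) ∂Q ≤ ∫⁻ a, liminf (fun k => Ψ a (ν k a)) atTop ∂Q := by
        refine lintegral_mono_ae ?_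
        filter_upwards [hlim] with a ha
        have ha' : Tendsto (fun k => ν k a) atTop (𝓝[C] (w a)) :=
          tendsto_nhdsWithin_iff.2 ⟨ha, Eventually.of_forall fun k => (hν k).2.1 a⟩
        exact (lowerSemicontinuousOn_iff_le_liminf.1 (hlsc a) _ (hw a)).trans
          (ha'.liminf_le_liminf_comp)
    _ ≤ liminf (fun k => ∫⁻ a, Ψ a (ν k a) ∂Q) atTop :=
        lintegral_liminf_le fun k => hmeas _ (hν k).1 (hν k).2.1
    _ ≤ liminf (fun _ : ℕ => b) atTop :=
        liminf_le_liminf (Eventually.of_forall fun k => (hν k).2.2)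
    _ = b := liminf_const b

theorem isClosed_constrainedLp [NeZero Q] (hC : IsClosed C)
    (hmeas : ∀ ν, Measurable ν → (∀ a, ν a ∈ C) → Measurable fun a => Ψ a (ν a))
    (hlsc : ∀ a, LowerSemicontinuousOn (Ψ a) C) : IsClosed (constrainedLp Q C Ψ b) := by
  refine IsSeqClosed.isClosed fun u v hu huv => ?_
  choose ν hν huν using hu
  obtain ⟨ns, -, hns⟩ := (tendstoInMeasure_of_tendsto_Lp huv).exists_seq_tendsto_ae
  have hlim : ∀ᵐ a ∂Q, Tendsto (fun k => ν (ns k) a) atTop (𝓝 (v a)) := by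
    filter_upwards [hns, ae_all_iff.2 huν] with a h hνa
    simpa only [hνa] using h
  have hvC : ∀ᵐ a ∂Q, v a ∈ C := hlim.mono fun a ha =>
    hC.mem_of_tendsto ha (Eventually.of_forall fun k => (hν (ns k)).2.1 a)
  obtain ⟨a₀, ha₀⟩ := hvC.exists
  obtain ⟨w, hw, hwC, hvw⟩ :=
    (Lp.aestronglyMeasurable v).aemeasurable.exists_ae_eq_range_subset hvC ⟨_, ha₀⟩
  have hwC (a : α) : w a ∈ C := hwC ⟨a, rfl⟩
  refine ⟨w, ⟨hw, hwC, lintegral_le_of_tendsto_ae hmeas hlsc (fun k => hν (ns k)) hwC ?_⟩, hvw⟩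
  filter_upwards [hlim, hvw] with a ha hva
  rwa [← hva]

variable [IsFiniteMeasure Q]

theorem isBounded_constrainedLp (hC : Bornology.IsBounded C) :
    Bornology.IsBounded (constrainedLp Q C Ψ b) := by
  obtain ⟨B, hB0, hB⟩ := hC.exists_pos_norm_le
  refine isBounded_iff_forall_norm_le.2
    ⟨measureUnivNNReal Q ^ (2 : ℝ≥0∞).toReal⁻¹ * B, ?_⟩
  rintro u ⟨ν, ⟨-, hνC, -⟩, huν⟩
  exact Lp.norm_le_of_ae_bound hB0.le (huν.mono fun a ha => ha ▸ hB _ (hνC a))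

theorem image_innerSL_constrainedLp (hC : Bornology.IsBounded C) :
    innerSL ℝ (indicatorConstLp 2 MeasurableSet.univ (measure_ne_top Q Set.univ) (1 : ℝ)) ''
      constrainedLp Q C Ψ b = (fun ν => ∫ a, ν a ∂Q) '' constrainedFunctions Q C Ψ b := by
  have integral_eq {u : Lp ℝ 2 Q} {ν : α → ℝ} (h : u =ᵐ[Q] ν) : innerSL ℝ (indicatorConstLp 2
      MeasurableSet.univ (measure_ne_top Q Set.univ) (1 : ℝ)) u = ∫ a, ν a ∂Q := by
    rw [innerSL_apply_apply, L2.inner_indicatorConstLp_one, Measure.restrict_univ,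
      integral_congr_ae h]
  obtain ⟨B, hB⟩ := hC.exists_norm_le
  ext x
  constructor
  · rintro ⟨u, ⟨ν, hν, huν⟩, rfl⟩
    exact ⟨ν, hν, (integral_eq huν).symm⟩
  · rintro ⟨ν, hν, rfl⟩
    have hLp : MemLp ν 2 Q :=
      MemLp.of_bound hν.1.aestronglyMeasurable B (ae_of_all _ fun a => hB _ (hν.2.1 a))
    exact ⟨hLp.toLp ν, ⟨ν, hν, hLp.coeFn_toLp⟩, integral_eq hLp.coeFn_toLp⟩

theorem isCompact_integral_constrainedFunctions [NeZero Q] (hC : IsCompact C)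
    (hmeas : ∀ ν, Measurable ν → (∀ a, ν a ∈ C) → Measurable fun a => Ψ a (ν a))
    (hconv : ∀ a, ConvexOn ℝ≥0 C (Ψ a)) (hlsc : ∀ a, LowerSemicontinuousOn (Ψ a) C) :
    IsCompact ((fun ν => ∫ a, ν a ∂Q) '' constrainedFunctions Q C Ψ b) := by
  rw [← image_innerSL_constrainedLp hC.isBounded]
  exact isCompact_image_of_isClosed_convex_isBounded
    (isClosed_constrainedLp hC.isClosed hmeas hlsc) (convex_constrainedLp hmeas hconv)
    (isBounded_constrainedLp hC.isBounded) _

end IntegralConstraint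

/-! ### The optimal log-wealth as a function of the mean -/

section OptLogWealth

/-- The return at outcome `c` of a unit stake split between the outcomes `1` and `0` in proportion
`w : 1 - w`, at even odds. -/
def payoff (w c : ℝ) : ℝ := (1 - w) * (1 - c) + w * c

/-- The log-wealth earned on the outcomes `c` by the bet with proportions `w : 1 - w`, at the
common odds for which its return at the mean outcome `m` is `1`. For fixed `w` it is convex in `m`,
whereas the sum in `optLogWealth` is concave in `m` for a fixed bet `l`. -/
def logGain {n : ℕ} (c : Fin n → ℝ) (w m : ℝ) : ℝ :=
  ∑ i, Real.log (payoff w (c i) / payoff w m)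

variable {w l m : ℝ}

@[fun_prop]
theorem continuous_payoff {α : Type*} [TopologicalSpace α] {u v : α → ℝ} (hu : Continuous u)
    (hv : Continuous v) : Continuous fun a => payoff (u a) (v a) := by
  unfold payoff
  fun_prop

theorem payoff_pos (hw : w ∈ Set.Ioo (0 : ℝ) 1) (hm : m ∈ Set.Icc (0 : ℝ) 1) :
    0 < payoff w m := by
  have h : min (1 - w) w ≤ (1 - m) • (1 - w) + m • w :=
    Convex.min_le_combo _ _ (sub_nonneg.2 hm.2) hm.1 (sub_add_cancel _ _)
  refine (lt_min (sub_pos.2 hw.2) hw.1).trans_le (h.trans_eq ?_)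
  simp only [payoff, smul_eq_mul]
  ring

theorem exists_mem_betRange_eq_payoff_div (hw : w ∈ Set.Icc (0 : ℝ) 1) (hm : 0 < payoff w m) :
    ∃ l ∈ betRange m, ∀ c, 1 + l * (c - m) = payoff w c / payoff w m := by
  have hl (c : ℝ) : 1 + (2 * w - 1) / payoff w m * (c - m) = payoff w c / payoff w m := by
    field_simp
    unfold payoff; ring
  refine ⟨_, ⟨?_, ?_⟩, hl⟩
  · have : 0 ≤ payoff w 1 / payoff w m := div_nonneg (by simp [payoff, hw.1]) hm.le
    linarith [hl 1]
  · have : 0 ≤ payoff w 0 / payoff w m := div_nonneg (by simp [payoff, hw.2]) hm.le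
    linarith [hl 0]

theorem exists_mem_Icc_payoff_div_eq (hm : m ∈ Set.Icc (0 : ℝ) 1) (hl : l ∈ betRange m) :
    ∃ w ∈ Set.Icc (0 : ℝ) 1, 0 < payoff w m ∧
      ∀ c, payoff w c / payoff w m = 1 + l * (c - m) := by
  obtain ⟨hl1, hl0⟩ := hl
  have hs : 0 < 2 + l * (1 - 2 * m) := by
    rcases le_total l 0 with _ | _ <;> nlinarith [hm.1, hm.2]
  have hpay (c : ℝ) : payoff ((1 + l * (1 - m)) / (2 + l * (1 - 2 * m))) c =
      (1 + l * (c - m)) / (2 + l * (1 - 2 * m)) := by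
    have hw := div_mul_cancel₀ (1 + l * (1 - m)) hs.ne'
    rw [eq_div_iff hs.ne']
    unfold payoff
    linear_combination (2 * c - 1) * hw
  refine ⟨(1 + l * (1 - m)) / (2 + l * (1 - 2 * m)), ⟨div_nonneg (by linarith) hs.le,
    (div_le_one hs).2 (by linarith)⟩, ?_, fun c => ?_⟩
  · rw [hpay, sub_self, mul_zero, add_zero]
    exact one_div_pos.2 hs
  · rw [hpay, hpay, div_div_div_cancel_right₀ hs.ne', sub_self, mul_zero, add_zero, div_one]

variable {n : ℕ} {c : Fin n → ℝ}

theorem sum_log_ofReal_eq_coe_logGain (hm : 0 < payoff w m) (hc : ∀ i, 0 < payoff w (c i)) :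
    ∑ i, ENNReal.log (ENNReal.ofReal (payoff w (c i) / payoff w m)) = (logGain c w m : EReal) := by
  have hpos (i : Fin n) : 0 < payoff w (c i) / payoff w m := div_pos (hc i) hm
  rw [sum_log_eq_log_prod, ← ENNReal.ofReal_prod_of_nonneg fun i _ => (hpos i).le,
    ENNReal.log_ofReal_of_pos (Finset.prod_pos fun i _ => hpos i),
    Real.log_prod fun i _ => (hpos i).ne', logGain]

theorem logGain_le_iSup_logGain (hw : w ∈ Set.Icc (0 : ℝ) 1) (hm : 0 < payoff w m)
    (hc : ∀ i, 0 < payoff w (c i)) :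
    (logGain c w m : EReal) ≤ ⨆ v ∈ Set.Ioo (0 : ℝ) 1, (logGain c v m : EReal) := by
  have hlim : Tendsto (fun v => (logGain c v m : EReal)) (𝓝[Set.Ioo 0 1] w)
      (𝓝 (logGain c w m)) := by
    refine (continuous_coe_real_ereal.tendsto _).comp (tendsto_finsetSum _ fun i _ => ?_)
    have hcont (x : ℝ) : ContinuousAt (fun v => payoff v x) w := by fun_prop
    exact (((hcont (c i)).div (hcont m) hm.ne').log (div_pos (hc i) hm).ne').mono_left
      nhdsWithin_le_nhds
  have : (𝓝[Set.Ioo 0 1] w).NeBot := by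
    rwa [← mem_closure_iff_nhdsWithin_neBot, closure_Ioo zero_ne_one]
  refine le_of_tendsto hlim (eventually_mem_nhdsWithin.mono fun v hv => ?_)
  exact le_iSup₂ (f := fun v (_ : v ∈ Set.Ioo (0 : ℝ) 1) => (logGain c v m : EReal)) v hv

theorem optLogWealth_eq_iSup_logGain (hc : ∀ i, c i ∈ Set.Icc (0 : ℝ) 1)
    (hm : m ∈ Set.Icc (0 : ℝ) 1) :
    optLogWealth c m = ⨆ w ∈ Set.Ioo (0 : ℝ) 1, (logGain c w m : EReal) := by
  refine le_antisymm (iSup₂_le fun l hl => ?_) (iSup₂_le fun w hw => ?_)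
  · obtain ⟨w, hw, hwm, hwc⟩ := exists_mem_Icc_payoff_div_eq hm hl
    simp only [← hwc]
    by_cases hpos : ∀ i, 0 < payoff w (c i)
    · rw [sum_log_ofReal_eq_coe_logGain hwm hpos]
      exact logGain_le_iSup_logGain hw hwm hpos
    · push Not at hpos
      obtain ⟨i, hi⟩ := hpos
      rw [sum_log_eq_log_prod, Finset.prod_eq_zero (Finset.mem_univ i)
        (ENNReal.ofReal_of_nonpos (div_nonpos_of_nonpos_of_nonneg hi hwm.le)), ENNReal.log_zero]
      exact bot_le
  · obtain ⟨l, hl, hlc⟩ :=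
      exists_mem_betRange_eq_payoff_div (Set.Ioo_subset_Icc_self hw) (payoff_pos hw hm)
    rw [← sum_log_ofReal_eq_coe_logGain (payoff_pos hw hm) fun i => payoff_pos hw (hc i)]
    simp only [← hlc]
    exact le_iSup₂ (f := fun l (_ : l ∈ betRange m) =>
      ∑ i, ENNReal.log (ENNReal.ofReal (1 + l * (c i - m)))) l hl

theorem ofReal_logGain_le_toENNReal_optLogWealth (hc : ∀ i, c i ∈ Set.Icc (0 : ℝ) 1)
    (hw : w ∈ Set.Ioo (0 : ℝ) 1) (hm : m ∈ Set.Icc (0 : ℝ) 1) :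
    ENNReal.ofReal (logGain c w m) ≤ (optLogWealth c m).toENNReal := by
  rw [← EReal.real_coe_toENNReal, optLogWealth_eq_iSup_logGain hc hm]
  exact EReal.toENNReal_le_toENNReal
    (le_iSup₂ (f := fun v (_ : v ∈ Set.Ioo (0 : ℝ) 1) => (logGain c v m : EReal)) w hw)

theorem convexOn_logGain (hc : ∀ i, c i ∈ Set.Icc (0 : ℝ) 1) (hw : w ∈ Set.Ioo (0 : ℝ) 1) :
    ConvexOn ℝ (Set.Icc 0 1) (logGain c w) := by
  refine ⟨convex_Icc 0 1, fun u hu v hv a b ha hb hab => ?_⟩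
  have hpay : payoff w (a • u + b • v) = a • payoff w u + b • payoff w v := by
    obtain rfl := eq_sub_of_add_eq hab
    simp only [payoff, smul_eq_mul]; ring
  have hlog (i : Fin n) {x : ℝ} (hx : x ∈ Set.Icc (0 : ℝ) 1) :
      Real.log (payoff w (c i) / payoff w x) =
        Real.log (payoff w (c i)) - Real.log (payoff w x) :=
    Real.log_div (payoff_pos hw (hc i)).ne' (payoff_pos hw hx).ne'
  have hconc := strictConcaveOn_log_Ioi.concaveOn.2 (payoff_pos hw hu) (payoff_pos hw hv) ha hb hab
  simp only [logGain, smul_eq_mul, Finset.mul_sum, ← Finset.sum_add_distrib]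
  refine Finset.sum_le_sum fun i _ => ?_
  rw [← smul_eq_mul, ← smul_eq_mul b, hlog i (convex_Icc 0 1 hu hv ha hb hab), hlog i hu,
    hlog i hv, hpay]
  obtain rfl := eq_sub_of_add_eq hab
  simp only [smul_eq_mul] at hconc ⊢
  linarith

theorem convexOn_toENNReal_optLogWealth (hc : ∀ i, c i ∈ Set.Icc (0 : ℝ) 1) :
    ConvexOn ℝ≥0 (Set.Icc 0 1) fun m => (optLogWealth c m).toENNReal := by
  refine ⟨fun u hu v hv a b _ _ hab => convex_Icc 0 1 hu hv a.2 b.2 (by exact_mod_cast hab),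
    fun u hu v hv a b _ _ hab => ?_⟩
  have hab' : (a : ℝ) + b = 1 := by exact_mod_cast hab
  rw [← EReal.toENNReal_coe (x := a • _ + b • _)]
  refine EReal.toENNReal_le_toENNReal ((optLogWealth_eq_iSup_logGain hc
    (convex_Icc 0 1 hu hv a.2 b.2 hab')).trans_le (iSup₂_le fun w hw => ?_))
  calc (logGain c w (a • u + b • v) : EReal) ≤ (a * logGain c w u + b * logGain c w v : ℝ) :=
        EReal.coe_le_coe_iff.2 ((convexOn_logGain hc hw).2 hu hv a.2 b.2 hab')
    _ ≤ (ENNReal.ofReal (a * logGain c w u + b * logGain c w v) : EReal) := by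
        rw [EReal.coe_ennreal_ofReal]
        exact EReal.coe_le_coe_iff.2 (le_max_left _ _)
    _ ≤ _ := by
        rw [EReal.coe_ennreal_le_coe_ennreal_iff]
        refine ENNReal.ofReal_add_le.trans (add_le_add ?_ ?_) <;>
          rw [ENNReal.ofReal_mul (NNReal.coe_nonneg _), ENNReal.ofReal_coe_nnreal] <;>
          exact mul_le_mul_right (ofReal_logGain_le_toENNReal_optLogWealth hc hw ‹_›) _

theorem lowerSemicontinuousOn_toENNReal_optLogWealth (n : ℕ) :
    LowerSemicontinuousOn (fun z : (Fin n → ℝ) × ℝ => (optLogWealth z.1 z.2).toENNReal)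
      (Set.univ.pi (fun _ => Set.Icc 0 1) ×ˢ Set.Icc 0 1) := by
  refine EReal.continuous_toENNReal.comp_lowerSemicontinuousOn (g := EReal.toENNReal) ?_
    fun _ _ h => EReal.toENNReal_le_toENNReal h
  have hsup : LowerSemicontinuousOn
      (fun z : (Fin n → ℝ) × ℝ => ⨆ w ∈ Set.Ioo (0 : ℝ) 1, (logGain z.1 w z.2 : EReal))
      (Set.univ.pi (fun _ => Set.Icc 0 1) ×ˢ Set.Icc 0 1) := by
    refine lowerSemicontinuousOn_biSup fun w hw => ContinuousOn.lowerSemicontinuousOn ?_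
    refine continuous_coe_real_ereal.comp_continuousOn (continuousOn_finsetSum _ fun i _ => ?_)
    have hpos {z : (Fin n → ℝ) × ℝ} (hz : z ∈ Set.univ.pi (fun _ => Set.Icc 0 1) ×ˢ Set.Icc 0 1) :
        0 < payoff w (z.1 i) ∧ 0 < payoff w z.2 :=
      ⟨payoff_pos hw (hz.1 i trivial), payoff_pos hw hz.2⟩
    exact ContinuousOn.log (.div (by fun_prop) (by fun_prop) fun z hz => (hpos hz).2.ne')
      fun z hz => (div_pos (hpos hz).1 (hpos hz).2).ne'
  have heq {z : (Fin n → ℝ) × ℝ} (hz : z ∈ Set.univ.pi (fun _ => Set.Icc 0 1) ×ˢ Set.Icc 0 1) :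
      (⨆ w ∈ Set.Ioo (0 : ℝ) 1, (logGain z.1 w z.2 : EReal)) = optLogWealth z.1 z.2 :=
    (optLogWealth_eq_iSup_logGain (fun i => hz.1 i trivial) hz.2).symm
  exact fun z hz => LowerSemicontinuousWithinAt.congr_of_eventuallyEq (hsup z hz) hz
    (eventually_mem_nhdsWithin.mono fun y hy => heq hy)

theorem measurable_comp_of_lowerSemicontinuousOn {α β : Type*} [MeasurableSpace α]
    [TopologicalSpace β] [MeasurableSpace β] [OpensMeasurableSpace β] {f : β → ℝ≥0∞} {s : Set β}
    (hf : LowerSemicontinuousOn f s) {g : α → β} (hg : Measurable g) (hgs : ∀ a, g a ∈ s) :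
    Measurable fun a => f (g a) :=
  (lowerSemicontinuous_restrict_iff.2 hf).measurable.comp (hg.subtype_mk (h := hgs))

theorem measurable_toENNReal_optLogWealth {α : Type*} [MeasurableSpace α] {c : α → Fin n → ℝ}
    {ν : α → ℝ} (hc : Measurable c) (hc01 : ∀ a i, c a i ∈ Set.Icc (0 : ℝ) 1) (hν : Measurable ν)
    (hν01 : ∀ a, ν a ∈ Set.Icc (0 : ℝ) 1) :
    Measurable fun a => (optLogWealth (c a) (ν a)).toENNReal := by
  have h := measurable_comp_of_lowerSemicontinuousOn
    (lowerSemicontinuousOn_toENNReal_optLogWealth n) (hc.prodMk hν)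
    fun a => ⟨fun i _ => hc01 a i, hν01 a⟩
  exact h

theorem sum_div_mem_Icc (hc : ∀ i, c i ∈ Set.Icc (0 : ℝ) 1) :
    (∑ i, c i) / n ∈ Set.Icc (0 : ℝ) 1 := by
  refine ⟨div_nonneg (Finset.sum_nonneg fun i _ => (hc i).1) n.cast_nonneg,
    div_le_one_of_le₀ ?_ n.cast_nonneg⟩
  simpa using Finset.sum_le_card_nsmul Finset.univ c 1 fun i _ => (hc i).2

theorem optLogWealth_sum_div (hc : ∀ i, c i ∈ Set.Icc (0 : ℝ) 1) :
    optLogWealth c ((∑ i, c i) / n) = 0 := by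
  refine le_antisymm ?_ (optLogWealth_nonneg _ _)
  rw [optLogWealth_eq_iSup_logGain hc (sum_div_mem_Icc hc)]
  refine iSup₂_le fun w hw => EReal.coe_nonpos.2 ?_
  set m := (∑ i, c i) / n
  have hm : 0 < payoff w m := payoff_pos hw (sum_div_mem_Icc hc)
  obtain ⟨l, -, hl⟩ := exists_mem_betRange_eq_payoff_div (Set.Ioo_subset_Icc_self hw) hm
  calc logGain c w m ≤ ∑ i, (payoff w (c i) / payoff w m - 1) := Finset.sum_le_sum fun i _ =>
        Real.log_le_sub_one_of_pos (div_pos (payoff_pos hw (hc i)) hm)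
    _ = l * (∑ i, c i - n * m) := by
        simp only [← hl, add_sub_cancel_left, ← Finset.mul_sum, Finset.sum_sub_distrib,
          Finset.sum_const, Finset.card_univ, Fintype.card_fin, nsmul_eq_mul]
    _ = 0 := by
        rcases eq_or_ne n 0 with rfl | hn
        · simp
        · rw [mul_div_cancel₀ _ (Nat.cast_ne_zero.2 hn), sub_self, mul_zero]

end OptLogWealth

/-! ### The confidence set -/

section ConfidenceSet

variable {Ω 𝒳 Θ : Type*} [MeasurableSpace Θ] {f : Θ × 𝒳 → ℝ} {P₀ Q : Measure Θ} {δ : ℝ} {n : ℕ}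

theorem complexity_add_log_nonneg (hδ : δ ∈ Set.Ioc (0 : ℝ) 1) :
    0 ≤ complexity P₀ Q n + (Real.log (1 / δ) : EReal) :=
  add_nonneg (add_nonneg (EReal.coe_ennreal_nonneg _)
    (EReal.coe_nonneg.2 (Real.log_nonneg (one_le_ktRegret n))))
    (EReal.coe_nonneg.2 (Real.log_nonneg ((one_le_div hδ.1).2 hδ.2)))

theorem feasibleMeans_eq_constrainedFunctions (hδ : δ ∈ Set.Ioc (0 : ℝ) 1) (x : Fin n → 𝒳) :
    feasibleMeans f P₀ Q δ x = constrainedFunctions Q (Set.Icc 0 1)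
      (fun θ m => (optLogWealth (fun i => f (θ, x i)) m).toENNReal)
      (complexity P₀ Q n + (Real.log (1 / δ) : EReal)).toENNReal := by
  ext ν
  rw [feasibleMeans, ← EReal.coe_toENNReal (complexity_add_log_nonneg hδ)]
  simp only [EReal.coe_ennreal_le_coe_ennreal_iff, EReal.toENNReal_coe]
  rfl

variable [MeasurableSpace 𝒳]

theorem isCompact_objectiveValues [IsProbabilityMeasure Q] (hf : Measurable f)
    (hf01 : ∀ z, f z ∈ Set.Icc (0 : ℝ) 1) (hδ : δ ∈ Set.Ioc (0 : ℝ) 1) (x : Fin n → 𝒳) :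
    IsCompact (objectiveValues f P₀ Q δ x) := by
  rw [objectiveValues, feasibleMeans_eq_constrainedFunctions hδ]
  refine isCompact_integral_constrainedFunctions isCompact_Icc (fun ν hν hν01 => ?_)
    (fun θ => convexOn_toENNReal_optLogWealth fun i => hf01 _) (fun θ => ?_)
  · have h := measurable_toENNReal_optLogWealth (c := fun θ i => f (θ, x i)) (by fun_prop)
      (fun θ i => hf01 _) hν hν01
    exact h
  · have h := (lowerSemicontinuousOn_toENNReal_optLogWealth n).comp
      (g := fun m : ℝ => ((fun i => f (θ, x i)), m)) (t := Set.Icc 0 1) (by fun_prop)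
      fun m hm => ⟨fun i _ => hf01 _, hm⟩
    exact h

theorem objectiveValues_nonempty (hf : Measurable f) (hf01 : ∀ z, f z ∈ Set.Icc (0 : ℝ) 1)
    (hδ : δ ∈ Set.Ioc (0 : ℝ) 1) (x : Fin n → 𝒳) : (objectiveValues f P₀ Q δ x).Nonempty := by
  refine ⟨_, fun θ => (∑ i, f (θ, x i)) / n, ⟨by fun_prop, fun θ => sum_div_mem_Icc fun i => hf01 _,
    ?_⟩, rfl⟩
  simpa only [optLogWealth_sum_div fun i => hf01 (_, x i), EReal.toENNReal_zero, lintegral_zero,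
    EReal.coe_ennreal_zero] using complexity_add_log_nonneg hδ

theorem mem_feasibleMeans_of_lintegral_mixtureWealth_le [IsProbabilityMeasure P₀]
    [IsProbabilityMeasure Q] (hf : Measurable f) (hf01 : ∀ z, f z ∈ Set.Icc (0 : ℝ) 1)
    (hδ : 0 < δ) {x : Fin n → 𝒳} {m : Θ → ℝ} (hm : Measurable m)
    (hm01 : ∀ θ, m θ ∈ Set.Icc (0 : ℝ) 1)
    (hle : ∫⁻ θ, mixtureWealth (fun i => f (θ, x i)) (m θ) ∂P₀ ≤ ENNReal.ofReal (1 / δ)) :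
    m ∈ feasibleMeans f P₀ Q δ x := by
  refine ⟨hm, hm01, (lintegral_le_klDiv_add_log_lintegral_exp (P := P₀) ?_).trans ?_⟩
  · have h := measurable_toENNReal_optLogWealth (c := fun θ i => f (θ, x i)) (by fun_prop)
      (fun θ i => hf01 _) hm hm01
    exact h
  · rw [complexity, add_assoc]
    refine add_le_add_right ?_ _
    simp only [EReal.coe_toENNReal (optLogWealth_nonneg _ _)]
    calc ENNReal.log (∫⁻ θ, (optLogWealth (fun i => f (θ, x i)) (m θ)).exp ∂P₀)
        ≤ ENNReal.log (ENNReal.ofReal (ktRegret n) *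
            ∫⁻ θ, mixtureWealth (fun i => f (θ, x i)) (m θ) ∂P₀) := by
          rw [← lintegral_const_mul' _ _ ENNReal.ofReal_ne_top]
          exact ENNReal.log_monotone <| lintegral_mono fun θ =>
            exp_optLogWealth_le_ktRegret_mul_mixtureWealth (fun i => hf01 _) (hm01 θ)
      _ ≤ ENNReal.log (ENNReal.ofReal (ktRegret n) * ENNReal.ofReal (1 / δ)) :=
          ENNReal.log_monotone (mul_le_mul_right hle _)
      _ = Real.log (ktRegret n) + Real.log (1 / δ) := by
          rw [ENNReal.log_mul_add, ENNReal.log_ofReal_of_pos (ktRegret_pos n),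
            ENNReal.log_ofReal_of_pos (one_div_pos.2 hδ)]

variable [MeasurableSpace Ω] {μ : Measure Ω} [IsProbabilityMeasure μ] [IsProbabilityMeasure P₀]
  {X : ℕ → Ω → 𝒳} {m : Θ → ℝ}

theorem mul_measure_exists_le_lintegral_mixtureWealth_le (hX : ∀ i, Measurable (X i))
    (hindep : iIndepFun X μ) (hf : Measurable f) (hf01 : ∀ z, f z ∈ Set.Icc (0 : ℝ) 1)
    (hm : Measurable m) (hmean : ∀ i θ, ∫ ω, f (θ, X i ω) ∂μ = m θ) (t : ℝ≥0∞) :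
    t * μ {ω | ∃ n, t ≤ ∫⁻ θ, mixtureWealth (fun i : Fin n => f (θ, X i ω)) (m θ) ∂P₀} ≤ 1 := by
  have := isProbabilityMeasureBeta one_half_pos one_half_pos
  set g : Θ × ℝ → 𝒳 → ℝ≥0∞ := fun a y => fairPayoff a.2 (m a.1) (f (a.1, y)) with hg
  have hgmeas : Measurable (Function.uncurry g) := by
    simp only [hg, Function.uncurry_def]; fun_prop
  have hmix (n : ℕ) (ω : Ω) : ∫⁻ θ, mixtureWealth (fun i : Fin n => f (θ, X i ω)) (m θ) ∂P₀ =
      ∫⁻ a, ∏ i : Fin n, g a (X i ω) ∂P₀.prod (betaMeasure (1 / 2) (1 / 2)) :=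
    (lintegral_prod (fun a => ∏ i : Fin n, g a (X i ω)) (by fun_prop)).symm
  simp only [hmix]
  refine mul_measure_exists_le_lintegral_prod_le hX hindep hgmeas ?_ t
  filter_upwards [Measure.quasiMeasurePreserving_snd.ae (ae_mem_Icc_betaMeasure _ _)] with a ha i
  simp only [hg, ← hmean i a.1]
  exact lintegral_fairPayoff_le_one (by fun_prop) (fun ω => hf01 _) ha

theorem exists_forall_mem_feasibleMeans (hX : ∀ i, Measurable (X i)) (hindep : iIndepFun X μ)
    (hf : Measurable f) (hf01 : ∀ z, f z ∈ Set.Icc (0 : ℝ) 1) (hδ : 0 < δ)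
    (hmean : ∀ i θ, ∫ ω, f (θ, X i ω) ∂μ = m θ) :
    ∃ E, MeasurableSet E ∧ 1 - δ ≤ μ.real E ∧ ∀ ω ∈ E, ∀ (n : ℕ) (Q : Measure Θ)
      [IsProbabilityMeasure Q], m ∈ feasibleMeans f P₀ Q δ fun i : Fin n => X i ω := by
  have hm : Measurable m := by
    rw [← funext (hmean 0)]
    exact (StronglyMeasurable.integral_prod_right' (f := fun z : Θ × Ω => f (z.1, X 0 z.2))
      (by fun_prop)).measurable
  have hm01 (θ : Θ) : m θ ∈ Set.Icc (0 : ℝ) 1 := by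
    rw [← hmean 0 θ]
    refine (convex_Icc 0 1).integral_mem isClosed_Icc (ae_of_all _ fun ω => hf01 _) ?_
    exact .of_mem_Icc 0 1 (by fun_prop) (ae_of_all _ fun ω => hf01 _)
  set N := {ω | ∃ n, ENNReal.ofReal (1 / δ) ≤
    ∫⁻ θ, mixtureWealth (fun i : Fin n => f (θ, X i ω)) (m θ) ∂P₀} with hN
  have hNδ : μ.real (toMeasurable μ N) ≤ δ := by
    have hville := mul_measure_exists_le_lintegral_mixtureWealth_le (P₀ := P₀) hX hindep hf hf01 hm
      hmean (ENNReal.ofReal (1 / δ))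
    rw [measureReal_def, measure_toMeasurable]
    refine ENNReal.toReal_le_of_le_ofReal hδ.le ?_
    rw [one_div, ENNReal.ofReal_inv_of_pos hδ,
      ENNReal.inv_mul_le_iff (ENNReal.ofReal_pos.2 hδ).ne' ENNReal.ofReal_ne_top,
      mul_one] at hville
    rwa [hN, one_div, ENNReal.ofReal_inv_of_pos hδ]
  refine ⟨(toMeasurable μ N)ᶜ, (measurableSet_toMeasurable _ _).compl, ?_, fun ω hω n Q _ => ?_⟩
  · rw [probReal_compl_eq_one_sub (measurableSet_toMeasurable _ _)]
    linarith
  · have hω : ω ∉ N := fun h => hω (subset_toMeasurable μ N h)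
    rw [hN, Set.mem_ofPred_eq, not_exists] at hω
    exact mem_feasibleMeans_of_lintegral_mixtureWealth_le hf hf01 hδ hm hm01 (not_le.1 (hω n)).le

end ConfidenceSet

theorem proposition4_general {Ω 𝒳 Θ : Type*} [MeasurableSpace Ω] [MeasurableSpace 𝒳]
    [MeasurableSpace Θ] (μ : Measure Ω) [IsProbabilityMeasure μ]
    (X : ℕ → Ω → 𝒳) (hX : ∀ i, Measurable (X i)) (hindep : iIndepFun X μ)
    (f : Θ × 𝒳 → ℝ) (hf : Measurable f) (hf01 : ∀ z, f z ∈ Set.Icc (0 : ℝ) 1)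
    (m : Θ → ℝ) (hmean : ∀ i θ, ∫ ω, f (θ, X i ω) ∂μ = m θ)
    (P₀ : Measure Θ) [IsProbabilityMeasure P₀] (δ : ℝ) (hδ : δ ∈ Set.Ioc (0 : ℝ) 1) :
    (∀ (n : ℕ) (x : Fin n → 𝒳) (Q : Measure Θ) [IsProbabilityMeasure Q],
      IsGreatest (objectiveValues f P₀ Q δ x) (maxMean f P₀ Q δ x) ∧
      IsLeast (objectiveValues f P₀ Q δ x) (minMean f P₀ Q δ x)) ∧
    ∃ E : Set Ω, MeasurableSet E ∧ 1 - δ ≤ μ.real E ∧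
      ∀ ω ∈ E, ∀ (n : ℕ) (Q : Measure Θ) [IsProbabilityMeasure Q],
        let S : Fin n → 𝒳 := fun i => X i ω
        minMean f P₀ Q δ S ≤ ∫ θ, m θ ∂Q ∧ ∫ θ, m θ ∂Q ≤ maxMean f P₀ Q δ S := by
  have hextrema (n : ℕ) (x : Fin n → 𝒳) (Q : Measure Θ) [IsProbabilityMeasure Q] :
      IsGreatest (objectiveValues f P₀ Q δ x) (maxMean f P₀ Q δ x) ∧
        IsLeast (objectiveValues f P₀ Q δ x) (minMean f P₀ Q δ x) :=
    have hcompact := isCompact_objectiveValues (P₀ := P₀) (Q := Q) hf hf01 hδ x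
    have hne := objectiveValues_nonempty (P₀ := P₀) (Q := Q) hf hf01 hδ x
    ⟨hcompact.isGreatest_sSup hne, hcompact.isLeast_sInf hne⟩
  refine ⟨fun n x Q _ => hextrema n x Q, ?_⟩
  obtain ⟨E, hE, hμE, hmem⟩ :=
    exists_forall_mem_feasibleMeans (P₀ := P₀) hX hindep hf hf01 hδ.1 hmean
  refine ⟨E, hE, hμE, fun ω hω n Q _ => ?_⟩
  have hmQ : ∫ θ, m θ ∂Q ∈ objectiveValues f P₀ Q δ fun i : Fin n => X i ω :=
    ⟨m, hmem ω hω n Q, rfl⟩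
  exact ⟨(hextrema n _ Q).2.2 hmQ, (hextrema n _ Q).1.2 hmQ⟩

end

theorem proposition4 {Ω 𝒳 Θ : Type*} [MeasurableSpace Ω] [MeasurableSpace 𝒳]
    [MeasurableSpace Θ] (μ : Measure Ω) [IsProbabilityMeasure μ]
    -- an i.i.d. sequence of data points
    (X : ℕ → Ω → 𝒳) (hX : ∀ i, Measurable (X i)) (hindep : iIndepFun X μ)
    (hident : ∀ i, IdentDistrib (X i) (X 0) μ μ)
    -- the function and the prior
    (f : Θ × 𝒳 → ℝ) (hf : Measurable f) (hf01 : ∀ z, f z ∈ Set.Icc (0 : ℝ) 1)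
    (P₀ : Measure Θ) [IsProbabilityMeasure P₀]
    (δ : ℝ) (hδ : δ ∈ Set.Ioc (0 : ℝ) 1) :
    -- the maximum and the minimum exist, for every sample and every posterior
    (∀ (n : ℕ) (x : Fin n → 𝒳) (Q : Measure Θ) [IsProbabilityMeasure Q],
      IsGreatest (objectiveValues f P₀ Q δ x) (maxMean f P₀ Q δ x) ∧
      IsLeast (objectiveValues f P₀ Q δ x) (minMean f P₀ Q δ x)) ∧
    -- simultaneous coverage for all sample sizes and all data-dependent posteriors
    ∃ E : Set Ω, MeasurableSet E ∧ 1 - δ ≤ μ.real E ∧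
      ∀ ω ∈ E, ∀ (n : ℕ) (P : Kernel (Fin n → 𝒳) Θ) [IsMarkovKernel P],
        let S : Fin n → 𝒳 := fun i => X i ω
        minMean f P₀ (P S) δ S ≤ ∫ θ, (∫ ω', f (θ, X 0 ω') ∂μ) ∂(P S) ∧
        ∫ θ, (∫ ω', f (θ, X 0 ω') ∂μ) ∂(P S) ≤ maxMean f P₀ (P S) δ S := by
  have hmean (i : ℕ) (θ : Θ) : ∫ ω, f (θ, X i ω) ∂μ = ∫ ω, f (θ, X 0 ω) ∂μ :=
    ((hident i).comp (hf.comp measurable_prodMk_left)).integral_eq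
  obtain ⟨hextrema, E, hE, hμE, hcover⟩ :=
    proposition4_general μ X hX hindep f hf hf01 _ hmean P₀ δ hδ
  exact ⟨hextrema, E, hE, hμE, fun ω hω n P _ => hcover ω hω n (P fun i => X i ω)⟩
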